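/- Let $G$ be a compactly generated locally compact Hausdorff group. Let $\mathrm{Sub}(G)$ be the space of closed subgroups of $G$ with the Chabauty topology, which is generated by the sets $\{H : H\cap U\neq\emptyset\}$ for $U\subset G$ open and $\{H : H\cap K=\emptyset\}$ for $K\subset G$ compact. Let $\mathrm{ULat}(G)\subset \mathrm{Sub}(G)$, with the induced topology, be the subspace of uniform lattices, i.e. of the discrete subgroups $\Gamma$ such that $G=\Gamma K$ for some compact $K\subset G$. Let $\mathrm{IRS}(G)$ be the space of invariant random subgroups of $G$, i.e. of the regular Borel probability measures on $\mathrm{Sub}(G)$ that are invariant under conjugation by every element of $G$, with the weak-$*$ topology. Then for every $\Gamma\in\mathrm{ULat}(G)$ there is a unique $G$-invariant regular Borel probability measure $\nu_\Gamma$ on $G/\Gamma$, its pushforward $\mu_\Gamma$ to $\mathrm{Sub}(G)$ under the map $g\Gamma\mapsto g\Gamma g^{-1}$ belongs to $\mathrm{IRS}(G)$, and the map $$\mathrm{I}:\mathrm{ULat}(G)\to\mathrm{IRS}(G),\qquad \mathrm{I}(\Gamma)=\mu_\Gamma,$$ is continuous. -/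

import Mathlib

open MeasureTheory Topology
open scoped Pointwise

theorem mem_map_conj_iff {G : Type*} [Group G] (g : G) (H : Subgroup G) (x : G) :
    x ∈ H.map (MulAut.conj g).toMonoidHom ↔ g⁻¹ * x * g ∈ H := by
  constructor
  · rintro ⟨y, hy, rfl⟩
    have h : g⁻¹ * (g * y * g⁻¹) * g = y := by group
    change g⁻¹ * (g * y * g⁻¹) * g ∈ H
    rw [h]
    exact hy
  · intro hx
    refine ⟨g⁻¹ * x * g, hx, ?_⟩
    change g * (g⁻¹ * x * g) * g⁻¹ = x
    group

section ChabautySpace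

variable {G : Type*} [Group G] [TopologicalSpace G]

/-- A topological group is compactly generated if some compact subset generates it as an
abstract group. -/
def IsCompactlyGeneratedGroup (G : Type*) [Group G] [TopologicalSpace G] : Prop :=
  ∃ S : Set G, IsCompact S ∧ Subgroup.closure S = ⊤

/-- The Chabauty topology on the set of closed subgroups: it is generated by the sets of closed
subgroups meeting a given open set and those of closed subgroups avoiding a given compact set. -/
instance chabautyTopology : TopologicalSpace (ClosedSubgroup G) :=
  TopologicalSpace.generateFrom
    ({O | ∃ U : Set G, IsOpen U ∧ O = {H : ClosedSubgroup G | ((H : Set G) ∩ U).Nonempty}} ∪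
     {O | ∃ K : Set G, IsCompact K ∧ O = {H : ClosedSubgroup G | (H : Set G) ∩ K = ∅}})

/-- The Borel sigma-algebra of the Chabauty space. -/
instance chabautyMeasurableSpace : MeasurableSpace (ClosedSubgroup G) :=
  borel (ClosedSubgroup G)

instance chabautyBorelSpace : BorelSpace (ClosedSubgroup G) := ⟨rfl⟩

/-- The closed subgroup `g H g⁻¹`. -/
def conjClosed [IsTopologicalGroup G] (g : G) (H : ClosedSubgroup G) : ClosedSubgroup G where
  toSubgroup := H.toSubgroup.map (MulAut.conj g).toMonoidHom
  isClosed' := by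
    have h : ((H.toSubgroup.map (MulAut.conj g).toMonoidHom : Subgroup G) : Set G) =
        (fun x : G => g⁻¹ * x * g) ⁻¹' (H.toSubgroup : Set G) :=
      Set.ext fun x => mem_map_conj_iff g H.toSubgroup x
    change IsClosed ((H.toSubgroup.map (MulAut.conj g).toMonoidHom : Subgroup G) : Set G)
    rw [h]
    exact H.isClosed'.preimage (by fun_prop)

/-- A uniform lattice: a discrete subgroup `Γ` with `G = Γ K` for some compact `K`. -/
def IsUniformLattice (Γ : Subgroup G) : Prop :=
  DiscreteTopology Γ ∧ ∃ K : Set G, IsCompact K ∧ (Γ : Set G) * K = Set.univ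

/-- The space of uniform lattices, with the topology induced from the Chabauty space. In a
Hausdorff group every discrete subgroup is closed, so no uniform lattice is left out. -/
abbrev ULat (G : Type*) [Group G] [TopologicalSpace G] : Type _ :=
  {Γ : ClosedSubgroup G // IsUniformLattice Γ.toSubgroup}

/-- The coset space `G ⧸ Γ`. -/
abbrev ULat.Cosets (Γ : ULat G) : Type _ := G ⧸ Γ.1.toSubgroup

/-- Borel measures on the coset space `G ⧸ Γ`. -/
abbrev ULat.CosetMeasure (Γ : ULat G) : Type _ := @Measure Γ.Cosets (borel Γ.Cosets)

/-- `ν` is a `G`-invariant regular Borel probability measure on `G ⧸ Γ`. -/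
structure ULat.IsInvariantProbability (Γ : ULat G) (ν : Γ.CosetMeasure) : Prop where
  isProbability : @IsProbabilityMeasure Γ.Cosets (borel Γ.Cosets) ν
  regular : @Measure.Regular Γ.Cosets (borel Γ.Cosets) _ ν
  invariant : ∀ g : G,
    @Measure.map Γ.Cosets Γ.Cosets (borel Γ.Cosets) (borel Γ.Cosets) (fun x => g • x) ν = ν

/-- The map `G ⧸ Γ → Sub G`, `g Γ ↦ g Γ g⁻¹`. -/
def ULat.cosetConj [IsTopologicalGroup G] (Γ : ULat G) : Γ.Cosets → ClosedSubgroup G :=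
  Quotient.lift (fun g : G => conjClosed g Γ.1) (by
    intro a b hab
    have hab' : a⁻¹ * b ∈ Γ.1.toSubgroup := QuotientGroup.leftRel_apply.mp hab
    apply ClosedSubgroup.toSubgroup_injective
    ext x
    change x ∈ Γ.1.toSubgroup.map (MulAut.conj a).toMonoidHom ↔
      x ∈ Γ.1.toSubgroup.map (MulAut.conj b).toMonoidHom
    rw [mem_map_conj_iff, mem_map_conj_iff]
    have h : b⁻¹ * x * b = (a⁻¹ * b)⁻¹ * (a⁻¹ * x * a) * (a⁻¹ * b) := by group
    rw [h, Subgroup.mul_mem_cancel_right _ hab',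
      Subgroup.mul_mem_cancel_left _ (Subgroup.inv_mem _ hab')])

/-- The pushforward to the Chabauty space of a Borel measure on `G ⧸ Γ` along
`g Γ ↦ g Γ g⁻¹`. -/
noncomputable def ULat.pushforward [IsTopologicalGroup G] (Γ : ULat G) (ν : Γ.CosetMeasure) :
    Measure (ClosedSubgroup G) :=
  @Measure.map Γ.Cosets (ClosedSubgroup G) (borel Γ.Cosets) _ Γ.cosetConj ν

/-- The space of invariant random subgroups: regular Borel probability measures on the Chabauty
space that are invariant under conjugation by every element of `G`. The topology is the one
induced from `ProbabilityMeasure`, that is, the weak-star topology (convergence of the integrals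
of all continuous functions on the compact space of closed subgroups). -/
abbrev IRS (G : Type*) [Group G] [TopologicalSpace G] [IsTopologicalGroup G] : Type _ :=
  {μ : ProbabilityMeasure (ClosedSubgroup G) //
    (μ : Measure (ClosedSubgroup G)).Regular ∧
    ∀ g : G, (μ : Measure (ClosedSubgroup G)).map (conjClosed g) = μ}

end ChabautySpace

/-
For a uniform lattice `Γ` choose a compactly supported `f ≥ 0` whose periodization
`P_Γ f (x Γ) = ∑ γ ∈ Γ, f (x γ)` is positive, and put `ψ = f / P_Γ f`. Then `ψ` is a Bruhat
function, `P_Γ ψ = 1`, and the invariant probability measure on `G ⧸ Γ` is `F ↦ (∫ ψ F) / ∫ ψ` with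
respect to Haar measure. Compact generation makes one `f` work for all lattices near `Γ`. The
periodizations themselves need not converge, since several points of a lattice `H` may merge as
`H → Γ`. However, if `W` is a small neighbourhood of `1` and `n = |H ∩ W|`, then each translate
`γ W` with `γ ∈ Γ` in a given compact set contains exactly `n` points of `H`. So `P_H f / n → P_Γ f`
locally uniformly, and `n` cancels in the quotient of integrals.
-/

section Chabauty

open Filter Set

variable {G X Y : Type*} [Group G] [TopologicalSpace G] [TopologicalSpace X] [TopologicalSpace Y]

theorem isOpen_setOf_inter_nonempty {U : Set G} (hU : IsOpen U) :
    IsOpen {H : ClosedSubgroup G | ((H : Set G) ∩ U).Nonempty} :=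
  TopologicalSpace.isOpen_generateFrom_of_mem (Or.inl ⟨U, hU, rfl⟩)

theorem isOpen_setOf_inter_eq_empty {K : Set G} (hK : IsCompact K) :
    IsOpen {H : ClosedSubgroup G | (H : Set G) ∩ K = ∅} :=
  TopologicalSpace.isOpen_generateFrom_of_mem (Or.inr ⟨K, hK, rfl⟩)

theorem isOpen_setOf_exists_mem {W : Set (X × G)} (hW : IsOpen W) :
    IsOpen {p : X × ClosedSubgroup G | ∃ h ∈ p.2, (p.1, h) ∈ W} := by
  refine isOpen_iff_mem_nhds.mpr ?_
  rintro ⟨x, H⟩ ⟨h, hh, hxh⟩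
  obtain ⟨V, U, hV, hU, hxV, hhU, hVU⟩ := isOpen_prod_iff.mp hW x h hxh
  filter_upwards [prod_mem_nhds (hV.mem_nhds hxV)
    ((isOpen_setOf_inter_nonempty hU).mem_nhds ⟨h, hh, hhU⟩)]
  rintro ⟨x', H'⟩ ⟨hx', h', hh', hh'U⟩
  exact ⟨h', hh', hVU ⟨hx', hh'U⟩⟩

theorem eventually_inter_subset {Γ : ClosedSubgroup G} {K U : Set G} (hK : IsCompact K)
    (hU : IsOpen U) (hΓ : (Γ : Set G) ∩ K ⊆ U) :
    ∀ᶠ H : ClosedSubgroup G in 𝓝 Γ, (H : Set G) ∩ K ⊆ U := by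
  have avoid_iff (H : ClosedSubgroup G) : (H : Set G) ∩ (K \ U) = ∅ ↔ (H : Set G) ∩ K ⊆ U := by
    rw [← inter_sdiff_assoc, sdiff_eq_empty]
  filter_upwards [(isOpen_setOf_inter_eq_empty (hK.diff hU)).mem_nhds ((avoid_iff Γ).mpr hΓ)]
    with H hH using (avoid_iff H).mp hH

theorem isClosed_setOf_mem [LocallyCompactSpace G] :
    IsClosed {p : G × ClosedSubgroup G | p.1 ∈ p.2} := by
  refine isOpen_compl_iff.mp (isOpen_iff_mem_nhds.mpr ?_)
  rintro ⟨x, H⟩ (hx : x ∉ H)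
  obtain ⟨K, hK, hxK, hKH⟩ := exists_compact_subset H.isClosed'.isOpen_compl hx
  have hHK : (H : Set G) ∩ K = ∅ := eq_empty_of_forall_notMem fun y hy => hKH hy.2 hy.1
  filter_upwards [prod_mem_nhds (isOpen_interior.mem_nhds hxK)
    ((isOpen_setOf_inter_eq_empty hK).mem_nhds hHK)]
  rintro ⟨y, H'⟩ ⟨hy, hH'⟩ (hyH' : y ∈ H')
  exact eq_empty_iff_forall_notMem.mp hH' y ⟨hyH', interior_subset hy⟩

theorem isOpen_setOf_forall_notMem [LocallyCompactSpace G] {K : Set Y} (hK : IsCompact K)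
    {b : X × Y → G} (hb : Continuous b) :
    IsOpen {p : X × ClosedSubgroup G | ∀ y ∈ K, b (p.1, y) ∉ p.2} := by
  have hopen : IsOpen {q : (X × ClosedSubgroup G) × Y | b (q.1.1, q.2) ∉ q.1.2} :=
    isClosed_setOf_mem.isOpen_compl.preimage
      (f := fun q : (X × ClosedSubgroup G) × Y => (b (q.1.1, q.2), q.1.2)) (by fun_prop)
  refine isOpen_iff_eventually.mpr fun p hp => ?_
  exact hK.eventually_forall_of_forall_eventually fun y hy => hopen.mem_nhds (hp y hy)

instance chabauty_t2Space [LocallyCompactSpace G] : T2Space (ClosedSubgroup G) := by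
  have separate {H₁ H₂ : ClosedSubgroup G} {x : G} (h₁ : x ∈ H₁) (h₂ : x ∉ H₂) :
      Disjoint (𝓝 H₁) (𝓝 H₂) := by
    obtain ⟨U, V, hU, hV, hxU, hHV, hUV⟩ :=
      isOpen_prod_iff.mp isClosed_setOf_mem.isOpen_compl x H₂ h₂
    refine Filter.disjoint_iff.mpr ⟨_, (isOpen_setOf_inter_nonempty hU).mem_nhds ⟨x, h₁, hxU⟩, V,
      hV.mem_nhds hHV, disjoint_left.mpr ?_⟩
    rintro H ⟨y, hyH, hyU⟩ hHV
    exact hUV (mk_mem_prod hyU hHV) hyH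
  refine t2Space_iff_disjoint_nhds.mpr fun H₁ H₂ hne => ?_
  obtain ⟨x, ⟨h₁, h₂⟩ | ⟨h₂, h₁⟩⟩ : ∃ x, x ∈ H₁ ∧ x ∉ H₂ ∨ x ∈ H₂ ∧ x ∉ H₁ := by
    by_contra! h
    exact hne (SetLike.ext fun x => ⟨(h x).1, (h x).2⟩)
  · exact separate h₁ h₂
  · exact (separate h₂ h₁).symm

variable [IsTopologicalGroup G]

theorem mem_conjClosed_iff {g x : G} {H : ClosedSubgroup G} :
    x ∈ conjClosed g H ↔ g⁻¹ * x * g ∈ H :=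
  mem_map_conj_iff g H.toSubgroup x

theorem conjClosed_conjClosed (g h : G) (H : ClosedSubgroup G) :
    conjClosed g (conjClosed h H) = conjClosed (g * h) H := by
  refine SetLike.ext fun x => ?_
  simp only [mem_conjClosed_iff, mul_inv_rev, mul_assoc]

theorem continuous_conjClosed [LocallyCompactSpace G] :
    Continuous fun p : G × ClosedSubgroup G => conjClosed p.1 p.2 := by
  refine continuous_generateFrom_iff.mpr ?_
  rintro _ (⟨U, hU, rfl⟩ | ⟨K, hK, rfl⟩)
  · convert isOpen_setOf_exists_mem
      (hU.preimage (f := fun q : G × G => q.1 * q.2 * q.1⁻¹) (by fun_prop)) using 1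
    ext ⟨g, H⟩
    constructor
    · rintro ⟨x, hx, hxU⟩
      exact ⟨_, mem_conjClosed_iff.mp hx, by simpa [mul_assoc] using hxU⟩
    · rintro ⟨h, hh, hhU⟩
      exact ⟨_, mem_conjClosed_iff.mpr (by simpa [mul_assoc] using hh), hhU⟩
  · convert isOpen_setOf_forall_notMem (X := G) hK
      (b := fun q : G × G => q.1⁻¹ * q.2 * q.1) (by fun_prop) using 1
    ext ⟨g, H⟩
    simp only [mem_preimage, mem_ofPred_eq, ← mem_conjClosed_iff, ← disjoint_iff_inter_eq_empty,
      disjoint_right]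
    rfl

end Chabauty

section Cocompactness

open Filter Set

variable {G : Type*} [Group G]

theorem eq_univ_of_mul_subset_of_closure_eq_top {S A : Set G} (hS : Subgroup.closure S = ⊤)
    (hA : A.Nonempty) (hSA : (S ∪ S⁻¹) * A ⊆ A) : A = univ := by
  have hstab : Subgroup.closure S ≤ MulAction.stabilizer G A := by
    refine (Subgroup.closure_le _).mpr fun s hs => Subset.antisymm ?_ ?_
    · rintro _ ⟨a, ha, rfl⟩
      exact hSA (mul_mem_mul (Or.inl hs) ha)
    · intro a ha
      exact mem_smul_set_iff_inv_smul_mem.mpr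
        (hSA (mul_mem_mul (Or.inr (inv_mem_inv.mpr hs)) ha))
  obtain ⟨a, ha⟩ := hA
  refine eq_univ_of_forall fun g => ?_
  have hg : (g * a⁻¹) • A = A := hstab (hS ▸ Subgroup.mem_top _)
  rw [← hg]
  exact ⟨a, ha, inv_mul_cancel_right g a⟩

variable [TopologicalSpace G] [IsTopologicalGroup G]

theorem eventually_subset_mul {Γ : ClosedSubgroup G} {C U : Set G} (hC : IsCompact C)
    (hU : IsOpen U) (hCU : C ⊆ U * (Γ : Set G)) :
    ∀ᶠ H : ClosedSubgroup G in 𝓝 Γ, C ⊆ U * (H : Set G) := by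
  have hopen : IsOpen {p : G × ClosedSubgroup G | ∃ h ∈ p.2, p.1 * h⁻¹ ∈ U} :=
    isOpen_setOf_exists_mem
      (hU.preimage (f := fun q : G × G => q.1 * q.2⁻¹) (by fun_prop))
  have hev : ∀ᶠ H : ClosedSubgroup G in 𝓝 Γ, ∀ x ∈ C, ∃ h ∈ H, x * h⁻¹ ∈ U := by
    refine hC.eventually_forall_of_forall_eventually fun x hx => ?_
    obtain ⟨u, hu, γ, hγ, rfl⟩ := hCU hx
    exact (hopen.preimage continuous_swap).mem_nhds ⟨γ, hγ, by simpa using hu⟩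
  filter_upwards [hev] with H hH x hx
  obtain ⟨h, hh, hxh⟩ := hH x hx
  exact ⟨x * h⁻¹, hxh, h, hh, inv_mul_cancel_right x h⟩

theorem eventually_mul_eq_univ [LocallyCompactSpace G] (hG : IsCompactlyGeneratedGroup G)
    {Γ : ClosedSubgroup G} {K : Set G} (hK : IsCompact K) (hΓ : K * (Γ : Set G) = univ) :
    ∃ L : Set G, IsCompact L ∧ ∀ᶠ H : ClosedSubgroup G in 𝓝 Γ, L * (H : Set G) = univ := by
  obtain ⟨S, hS, hSG⟩ := hG
  obtain ⟨L, hL, hKL⟩ := exists_compact_superset hK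
  have hcover : (S ∪ S⁻¹) * L ⊆ interior L * (Γ : Set G) :=
    (subset_univ _).trans (hΓ ▸ mul_subset_mul_right hKL)
  have hLΓ : (L * (Γ : Set G)).Nonempty :=
    univ_nonempty.mono (hΓ ▸ mul_subset_mul_right (hKL.trans interior_subset))
  refine ⟨L, hL, ?_⟩
  filter_upwards [eventually_subset_mul ((hS.union hS.inv).mul hL) isOpen_interior hcover]
    with H hH
  refine eq_univ_of_mul_subset_of_closure_eq_top hSG (hLΓ.of_mul_left.mul ⟨1, one_mem H⟩) ?_
  calc (S ∪ S⁻¹) * (L * (H : Set G)) = (S ∪ S⁻¹) * L * H := (mul_assoc _ _ _).symm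
    _ ⊆ L * H * H := mul_subset_mul_right (hH.trans (mul_subset_mul_right interior_subset))
    _ = L * H := by rw [mul_assoc, coe_mul_coe]

theorem IsUniformLattice.exists_isCompact_mul_eq_univ {Γ : Subgroup G} (hΓ : IsUniformLattice Γ) :
    ∃ K : Set G, IsCompact K ∧ K * (Γ : Set G) = univ := by
  obtain ⟨-, K, hK, hΓK⟩ := hΓ
  refine ⟨K⁻¹, hK.inv, ?_⟩
  rw [← inv_coe_set (H := Γ), ← mul_inv_rev, hΓK, inv_univ]

end Cocompactness

section Automorphize

open Set QuotientGroup

variable {G : Type*} [Group G] {Γ : Subgroup G}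

theorem automorphize_mk {M : Type*} [TopologicalSpace M] [AddCommMonoid M]
    (f : G → M) (g : G) : automorphize f (g : G ⧸ Γ) = ∑' γ : Γ, f (g * γ) :=
  (Γ.equivOp.tsum_eq fun γ : Γ.op => f (γ • g)).symm

theorem automorphize_comp_mul_left {M : Type*} [TopologicalSpace M] [AddCommMonoid M]
    (f : G → M) (h : G) (x : G ⧸ Γ) :
    automorphize (fun y => f (h * y)) x = automorphize f (h • x) := by
  induction x using QuotientGroup.induction_on with
  | H g => simp only [MulAction.Quotient.smul_coe, smul_eq_mul, automorphize_mk, mul_assoc]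

theorem automorphize_mul_comp_mk (f : G → ℝ) (F : G ⧸ Γ → ℝ) (x : G ⧸ Γ) :
    automorphize (fun y => f y * F y) x = automorphize f x * F x := by
  rw [mul_comm]
  convert congrFun (automorphize_smul_left f F) x using 2
  · exact funext fun y => mul_comm _ _
  · rfl

theorem automorphize_nonneg {f : G → ℝ} (hf : ∀ x, 0 ≤ f x) (x : G ⧸ Γ) :
    0 ≤ automorphize f x := by
  induction x using QuotientGroup.induction_on with
  | H g => exact automorphize_mk f g ▸ tsum_nonneg fun γ => hf _

variable [TopologicalSpace G] [IsTopologicalGroup G] [T2Space G] [DiscreteTopology Γ]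

theorem finite_inter_of_isCompact {C : Set G} (hC : IsCompact C) : ((Γ : Set G) ∩ C).Finite := by
  rw [← Subtype.image_preimage_coe]
  exact (tendsto_cofinite_cocompact_iff.mp (Γ.tendsto_coe_cofinite_of_discrete
    (isDiscrete_iff_discreteTopology.mpr inferInstance)) C hC).image _

variable {f : G → ℝ}

theorem finite_setOf_exists_mul_mem_support {A : Set G} (hA : IsCompact A)
    (hfc : HasCompactSupport f) : {γ : Γ | ∃ x ∈ A, f (x * γ) ≠ 0}.Finite := by
  refine ((finite_inter_of_isCompact (Γ := Γ) (hA.inv.mul hfc.isCompact)).preimage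
    Subtype.val_injective.injOn).subset ?_
  rintro γ ⟨x, hx, hfx⟩
  exact ⟨γ.2, x⁻¹, inv_mem_inv.mpr hx, x * γ, subset_tsupport f hfx, inv_mul_cancel_left _ _⟩

theorem hasFiniteSupport_comp_mul_left (hfc : HasCompactSupport f) (g : G) :
    (fun γ : Γ => f (g * γ)).HasFiniteSupport :=
  (finite_setOf_exists_mul_mem_support isCompact_singleton hfc).subset
    fun _ hγ => ⟨g, rfl, hγ⟩

theorem automorphize_mk_eq_finsum (hfc : HasCompactSupport f) (g : G) :
    automorphize f (g : G ⧸ Γ) = ∑ᶠ γ ∈ (Γ : Set G), f (g * γ) := by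
  rw [automorphize_mk, tsum_eq_finsum (hasFiniteSupport_comp_mul_left hfc g),
    ← finsum_set_coe_eq_finsum_mem]
  rfl

theorem automorphize_add {f₁ f₂ : G → ℝ} (h₁ : HasCompactSupport f₁) (h₂ : HasCompactSupport f₂)
    (x : G ⧸ Γ) :
    automorphize (fun y => f₁ y + f₂ y) x = automorphize f₁ x + automorphize f₂ x := by
  induction x using QuotientGroup.induction_on with
  | H g =>
    simp only [automorphize_mk]
    exact (summable_of_hasFiniteSupport (hasFiniteSupport_comp_mul_left h₁ g)).tsum_add
      (summable_of_hasFiniteSupport (hasFiniteSupport_comp_mul_left h₂ g))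

theorem automorphize_pos (hfc : HasCompactSupport f) (hf : ∀ x, 0 ≤ f x) {K : Set G}
    (hfK : ∀ x ∈ K, 0 < f x) (hKΓ : K * (Γ : Set G) = univ) (x : G ⧸ Γ) :
    0 < automorphize f x := by
  induction x using QuotientGroup.induction_on with
  | H g =>
    obtain ⟨k, hk, γ, hγ, rfl⟩ : g ∈ K * (Γ : Set G) := hKΓ ▸ mem_univ g
    rw [QuotientGroup.mk_mul_of_mem k hγ, automorphize_mk]
    exact (summable_of_hasFiniteSupport (hasFiniteSupport_comp_mul_left hfc k)).tsum_pos
      (fun γ => hf _) 1 (by simpa using hfK k hk)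

theorem continuous_automorphize [LocallyCompactSpace G] (hf : Continuous f)
    (hfc : HasCompactSupport f) : Continuous (automorphize f : G ⧸ Γ → ℝ) := by
  have hlf : LocallyFinite fun γ : Γ => Function.support fun g => f (g * γ) := by
    intro g
    obtain ⟨V, hV, hVg⟩ := exists_compact_mem_nhds g
    refine ⟨V, hVg, (finite_setOf_exists_mul_mem_support hV hfc).subset ?_⟩
    rintro γ ⟨x, hx, hxV⟩
    exact ⟨x, hxV, hx⟩
  refine isQuotientMap_quotient_mk'.continuous_iff.mpr ?_
  convert continuous_finsum (fun γ : Γ => (by fun_prop : Continuous fun g => f (g * γ))) hlf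
  exact (automorphize_mk f _).trans (tsum_eq_finsum (hasFiniteSupport_comp_mul_left hfc _))

variable [MeasurableSpace G] [BorelSpace G] {μ : Measure G} [IsFiniteMeasureOnCompacts μ]
  {f₁ f₂ : G → ℝ}

theorem integral_mul_automorphize_eq_finsum (h₁ : Continuous f₁) (hc₁ : HasCompactSupport f₁)
    (h₂ : Continuous f₂) (hc₂ : HasCompactSupport f₂) :
    ∫ x, f₁ x * automorphize f₂ (x : G ⧸ Γ) ∂μ = ∑ᶠ γ : Γ, ∫ x, f₁ x * f₂ (x * γ) ∂μ := by
  have hfin := finite_setOf_exists_mul_mem_support (Γ := Γ) hc₁.isCompact hc₂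
  have hzero {γ : Γ} (hγ : γ ∉ hfin.toFinset) (x : G) : f₁ x * f₂ (x * γ) = 0 := by
    by_contra h
    exact hγ (hfin.mem_toFinset.mpr
      ⟨x, subset_tsupport _ (left_ne_zero_of_mul h), right_ne_zero_of_mul h⟩)
  have hsum (x : G) : f₁ x * automorphize f₂ (x : G ⧸ Γ) =
      ∑ γ ∈ hfin.toFinset, f₁ x * f₂ (x * γ) := by
    rw [automorphize_mk, ← tsum_mul_left]
    exact tsum_eq_sum fun γ hγ => hzero hγ x
  have hsupp : (Function.support fun γ : Γ => ∫ x, f₁ x * f₂ (x * γ) ∂μ) ⊆ hfin.toFinset :=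
    fun γ hγ => not_not.mp fun h => hγ (by simp only [hzero h, integral_zero])
  rw [finsum_eq_sum_of_support_subset _ hsupp, integral_congr_ae (.of_forall hsum)]
  exact integral_finsetSum _ fun γ _ =>
    Continuous.integrable_of_hasCompactSupport (by fun_prop) hc₁.mul_right

/- Both sides are sums over `Γ`, matched by `γ ↦ γ⁻¹` and the right translations `x ↦ xγ`. -/
theorem integral_mul_automorphize_comm [μ.IsMulRightInvariant] (h₁ : Continuous f₁)
    (hc₁ : HasCompactSupport f₁) (h₂ : Continuous f₂) (hc₂ : HasCompactSupport f₂) :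
    ∫ x, f₁ x * automorphize f₂ (x : G ⧸ Γ) ∂μ = ∫ x, f₂ x * automorphize f₁ (x : G ⧸ Γ) ∂μ := by
  rw [integral_mul_automorphize_eq_finsum h₁ hc₁ h₂ hc₂,
    integral_mul_automorphize_eq_finsum h₂ hc₂ h₁ hc₁, ← finsum_comp_equiv (Equiv.inv Γ)]
  refine finsum_congr fun γ => ?_
  rw [← integral_mul_right_eq_self _ (γ : G)]
  simp [mul_comm]

end Automorphize

section Bruhat

open Set QuotientGroup

variable {G : Type*} [Group G] [TopologicalSpace G] {Γ : Subgroup G} {ψ : G → ℝ}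

/-- A Bruhat function for `Γ`: a nonnegative function in `C_c(G)` whose sum over every left coset
of `Γ` is `1`. Integration against it turns integrals over `G ⧸ Γ` into integrals over `G`. -/
structure IsBruhatFunction (Γ : Subgroup G) (ψ : G → ℝ) : Prop where
  continuous : Continuous ψ
  hasCompactSupport : HasCompactSupport ψ
  nonneg : ∀ x, 0 ≤ ψ x
  automorphize_eq_one : ∀ x : G ⧸ Γ, automorphize ψ x = 1

theorem IsBruhatFunction.exists_mem_support (hψ : IsBruhatFunction Γ ψ) (g : G) :
    ∃ γ ∈ Γ, ψ (g * γ) ≠ 0 := by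
  by_contra! h
  have hg := hψ.automorphize_eq_one g
  rw [automorphize_mk, tsum_congr fun γ : Γ => h γ γ.2, tsum_zero] at hg
  exact zero_ne_one hg

theorem IsBruhatFunction.compactSpace (hψ : IsBruhatFunction Γ ψ) : CompactSpace (G ⧸ Γ) := by
  refine ⟨(hψ.hasCompactSupport.isCompact.image QuotientGroup.continuous_mk).of_isClosed_subset
    isClosed_univ fun x _ => ?_⟩
  obtain ⟨g, rfl⟩ := QuotientGroup.mk_surjective x
  obtain ⟨γ, hγ, hne⟩ := hψ.exists_mem_support g
  exact ⟨g * γ, subset_tsupport ψ hne, QuotientGroup.mk_mul_of_mem g hγ⟩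

theorem IsBruhatFunction.integral_pos [MeasurableSpace G] [OpensMeasurableSpace G]
    {μ : Measure G} [IsFiniteMeasureOnCompacts μ] [μ.IsOpenPosMeasure]
    (hψ : IsBruhatFunction Γ ψ) : 0 < ∫ x, ψ x ∂μ := by
  obtain ⟨γ, -, hne⟩ := hψ.exists_mem_support 1
  exact hψ.continuous.integral_pos_of_hasCompactSupport_nonneg_nonzero hψ.hasCompactSupport
    hψ.nonneg hne

theorem IsBruhatFunction.integrable_mul [MeasurableSpace G] [OpensMeasurableSpace G]
    {μ : Measure G} [IsFiniteMeasureOnCompacts μ] (hψ : IsBruhatFunction Γ ψ) {u : G → ℝ}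
    (hu : Continuous u) : Integrable (fun x => ψ x * u x) μ :=
  (hψ.continuous.mul hu).integrable_of_hasCompactSupport hψ.hasCompactSupport.mul_right

variable [IsTopologicalGroup G] [T2Space G] [LocallyCompactSpace G] [DiscreteTopology Γ]

theorem isBruhatFunction_div_automorphize {f : G → ℝ} (hf : Continuous f)
    (hfc : HasCompactSupport f) (hf0 : ∀ x, 0 ≤ f x) (hpos : ∀ x : G ⧸ Γ, 0 < automorphize f x) :
    IsBruhatFunction Γ fun x => f x / automorphize f (x : G ⧸ Γ) where
  continuous := hf.div ((continuous_automorphize hf hfc).comp QuotientGroup.continuous_mk)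
    fun x => (hpos x).ne'
  hasCompactSupport := by
    simp only [div_eq_mul_inv]
    exact hfc.mul_right
  nonneg x := div_nonneg (hf0 x) (hpos x).le
  automorphize_eq_one x := by
    simp only [div_eq_mul_inv]
    exact (automorphize_mul_comp_mk f (fun y => (automorphize f y)⁻¹) x).trans
      (mul_inv_cancel₀ (hpos x).ne')

theorem exists_isBruhatFunction {K : Set G} (hK : IsCompact K) (hKΓ : K * (Γ : Set G) = univ) :
    ∃ ψ, IsBruhatFunction Γ ψ := by
  obtain ⟨f, hf1, -, hfc, hfI⟩ :=
    exists_continuous_one_zero_of_isCompact hK isClosed_empty (disjoint_empty K)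
  exact ⟨_, isBruhatFunction_div_automorphize f.continuous hfc (fun x => (hfI x).1)
    (automorphize_pos hfc (fun x => (hfI x).1) (fun x hx => by simp [hf1 hx]) hKΓ)⟩

variable [MeasurableSpace G] [BorelSpace G] {μ : Measure G}

omit [LocallyCompactSpace G] in
theorem IsBruhatFunction.integral_eq [IsFiniteMeasureOnCompacts μ] [μ.IsMulRightInvariant]
    (hψ : IsBruhatFunction Γ ψ) {f : G → ℝ} (hf : Continuous f) (hfc : HasCompactSupport f) :
    ∫ x, f x ∂μ = ∫ x, ψ x * automorphize f (x : G ⧸ Γ) ∂μ := by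
  rw [← integral_mul_automorphize_comm hf hfc hψ.continuous hψ.hasCompactSupport]
  simp only [hψ.automorphize_eq_one, mul_one]

omit [LocallyCompactSpace G] in
theorem IsBruhatFunction.integral_comp_mul_left [IsFiniteMeasureOnCompacts μ]
    [μ.IsMulRightInvariant] (hψ : IsBruhatFunction Γ ψ) (h : G) :
    ∫ x, ψ (h * x) ∂μ = ∫ x, ψ x ∂μ := by
  have hcont := hψ.continuous
  rw [hψ.integral_eq (f := fun x => ψ (h * x)) (by fun_prop)
    (hψ.hasCompactSupport.comp_homeomorph (Homeomorph.mulLeft h))]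
  simp only [automorphize_comp_mul_left, hψ.automorphize_eq_one, mul_one]

/- A right translate of `μ` is a multiple `c • μ`. Testing this on `x ↦ ψ x⁻¹`, whose integrals
are those of left translates of `ψ` for the right invariant measure `μ.inv`, gives `c = 1`. -/
theorem IsBruhatFunction.isMulRightInvariant (hψ : IsBruhatFunction Γ ψ) (μ : Measure G)
    [μ.IsHaarMeasure] [μ.Regular] : μ.IsMulRightInvariant := by
  have integral_inv (f : G → ℝ) : ∫ x, f x⁻¹ ∂μ = ∫ x, f x ∂μ.inv :=
    (integral_map_equiv (MeasurableEquiv.inv G) f).symm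
  have : IsFiniteMeasureOnCompacts μ.inv :=
    ⟨fun C hC => by simpa only [Measure.inv_apply] using hC.inv.measure_lt_top⟩
  have hψi : 0 < ∫ x, ψ x⁻¹ ∂μ := by
    obtain ⟨γ, -, hne⟩ := hψ.exists_mem_support 1
    have hcont := hψ.continuous
    exact Continuous.integral_pos_of_hasCompactSupport_nonneg_nonzero (x := (1 * γ)⁻¹)
      (by fun_prop) (hψ.hasCompactSupport.comp_homeomorph (Homeomorph.inv G))
      (fun x => hψ.nonneg _) (by simpa only [inv_inv])
  refine ⟨fun g => ?_⟩
  have : (Measure.map (· * g) μ).Regular := Measure.Regular.map (Homeomorph.mulRight g)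
  have hsmul := Measure.isMulLeftInvariant_eq_smul_of_regular (Measure.map (· * g) μ) μ
  have htranslate : ∫ x, ψ x⁻¹ ∂(Measure.map (· * g) μ) = ∫ x, ψ x⁻¹ ∂μ :=
    calc ∫ x, ψ x⁻¹ ∂(Measure.map (· * g) μ) = ∫ x, ψ (x * g)⁻¹ ∂μ :=
          integral_map_equiv (MeasurableEquiv.mulRight g) _
      _ = ∫ x, ψ (g⁻¹ * x) ∂μ.inv := by simp [← integral_inv]
      _ = ∫ x, ψ x⁻¹ ∂μ := by rw [hψ.integral_comp_mul_left, integral_inv]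
  rw [hsmul, integral_smul_nnreal_measure, NNReal.smul_def, smul_eq_mul,
    mul_eq_right₀ hψi.ne', NNReal.coe_eq_one] at htranslate
  rw [hsmul, htranslate, one_smul]

omit [LocallyCompactSpace G] in
theorem IsBruhatFunction.integral_mul_comp_smul [IsFiniteMeasureOnCompacts μ]
    [μ.IsMulLeftInvariant] [μ.IsMulRightInvariant] (hψ : IsBruhatFunction Γ ψ) {F : G ⧸ Γ → ℝ}
    (hF : Continuous F) (h : G) :
    ∫ x : G, ψ x * F (h • x) ∂μ = ∫ x : G, ψ x * F x ∂μ := by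
  have hcont := hψ.continuous
  have : Continuous fun x : G => F x := hF.comp QuotientGroup.continuous_mk
  calc ∫ x : G, ψ x * F (h • x) ∂μ = ∫ x : G, ψ (h⁻¹ * x) * F x ∂μ := by
        rw [← integral_mul_left_eq_self (fun x : G => ψ (h⁻¹ * x) * F x) h]
        simp
    _ = ∫ x : G, ψ x * automorphize (fun y : G => ψ (h⁻¹ * y) * F y) (x : G ⧸ Γ) ∂μ :=
        hψ.integral_eq (by fun_prop)
          (hψ.hasCompactSupport.comp_homeomorph (Homeomorph.mulLeft h⁻¹)).mul_right
    _ = ∫ x : G, ψ x * F x ∂μ := by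
        simp only [automorphize_mul_comp_mk, automorphize_comp_mul_left, hψ.automorphize_eq_one,
          one_mul]

end Bruhat

section QuotientMeasure

open Set QuotientGroup CompactlySupported

variable {G : Type*} [Group G] [TopologicalSpace G] [IsTopologicalGroup G] [T2Space G]
  {Γ : Subgroup G} [DiscreteTopology Γ]

theorem hasCompactSupport_automorphize {f : G → ℝ} (hfc : HasCompactSupport f) :
    HasCompactSupport (automorphize f : G ⧸ Γ → ℝ) := by
  refine .intro (hfc.isCompact.image QuotientGroup.continuous_mk) fun x hx => ?_
  induction x using QuotientGroup.induction_on with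
  | H g =>
    have hzero (γ : Γ) : f (g * γ) = 0 := by
      by_contra h
      exact hx ⟨g * γ, subset_tsupport f h, QuotientGroup.mk_mul_of_mem g γ.2⟩
    rw [automorphize_mk, tsum_congr hzero, tsum_zero]

variable [LocallyCompactSpace G] [MeasurableSpace (G ⧸ Γ)] [BorelSpace (G ⧸ Γ)]

/-- The positive functional `f ↦ ∫ automorphize f ∂ν` on `C_c(G)`, whose Riesz measure lifts the
measure `ν` on `G ⧸ Γ` to `G`. -/
noncomputable def automorphizeFunctional (ν : Measure (G ⧸ Γ)) [IsFiniteMeasureOnCompacts ν] :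
    C_c(G, ℝ) →ₚ[ℝ] ℝ :=
  PositiveLinearMap.mk₀
    { toFun := fun f => ∫ x : G ⧸ Γ, automorphize f x ∂ν
      map_add' := fun f₁ f₂ => by
        have integrable_automorphize (f : C_c(G, ℝ)) :
            Integrable (automorphize f : G ⧸ Γ → ℝ) ν :=
          (continuous_automorphize f.continuous f.2).integrable_of_hasCompactSupport
            (hasCompactSupport_automorphize f.2)
        exact (integral_congr_ae (.of_forall (automorphize_add f₁.2 f₂.2))).trans
          (integral_add (integrable_automorphize f₁) (integrable_automorphize f₂))
      map_smul' := fun c f => by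
        rw [RingHom.id_apply, ← integral_smul]
        refine integral_congr_ae (.of_forall fun x => ?_)
        have hmul := automorphize_mul_comp_mk f (fun _ => c) x
        simp only [mul_comm _ c] at hmul
        exact hmul }
    fun _ hf => integral_nonneg (automorphize_nonneg hf)

/- Weil's formula: the Riesz measure of `automorphizeFunctional ν` is left invariant, hence
proportional to Haar measure. -/
theorem exists_integral_automorphize_eq_mul_integral (ν : Measure (G ⧸ Γ))
    [IsFiniteMeasureOnCompacts ν] [SMulInvariantMeasure G (G ⧸ Γ) ν] [MeasurableSpace G]
    [BorelSpace G] (μ : Measure G) [μ.IsHaarMeasure] :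
    ∃ c : ℝ, ∀ f : G → ℝ, Continuous f → HasCompactSupport f →
      ∫ x : G ⧸ Γ, automorphize f x ∂ν = c * ∫ x, f x ∂μ := by
  set m : Measure G := RealRMK.rieszMeasure (automorphizeFunctional ν)
  have integral_m (f : C_c(G, ℝ)) : ∫ x, f x ∂m = ∫ x : G ⧸ Γ, automorphize f x ∂ν :=
    RealRMK.integral_rieszMeasure _ f
  have hm_regular : m.Regular := RealRMK.regular_rieszMeasure _
  have hm_inv : m.IsMulLeftInvariant := by
    refine ⟨fun h => ?_⟩
    have : (m.map (h * ·)).Regular := Measure.Regular.map (Homeomorph.mulLeft h)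
    refine Measure.ext_of_integral_eq_on_compactlySupported fun f => ?_
    let fh : C_c(G, ℝ) := ⟨⟨fun x => f (h * x), by fun_prop⟩,
      f.2.comp_homeomorph (Homeomorph.mulLeft h)⟩
    calc ∫ x, f x ∂(m.map (h * ·)) = ∫ x, fh x ∂m :=
          integral_map_equiv (MeasurableEquiv.mulLeft h) _
      _ = ∫ x : G ⧸ Γ, automorphize f (h • x) ∂ν :=
          (integral_m fh).trans
            (integral_congr_ae (.of_forall (automorphize_comp_mul_left f h)))
      _ = ∫ x, f x ∂m := by rw [integral_smul_eq_self, integral_m]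
  refine ⟨m.haarScalarFactor μ, fun f hf hfc => ?_⟩
  refine (integral_m ⟨⟨f, hf⟩, hfc⟩).symm.trans ?_
  refine (Measure.integral_isMulLeftInvariant_eq_smul_of_hasCompactSupport m μ hf hfc).trans ?_
  rw [integral_smul_nnreal_measure, NNReal.smul_def, smul_eq_mul]

namespace IsBruhatFunction

variable {ψ : G → ℝ} [MeasurableSpace G] [BorelSpace G]

theorem integral_eq_integral_mul_div (hψ : IsBruhatFunction Γ ψ) {ν : Measure (G ⧸ Γ)}
    [IsProbabilityMeasure ν] [SMulInvariantMeasure G (G ⧸ Γ) ν] (μ : Measure G) [μ.IsHaarMeasure]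
    {F : G ⧸ Γ → ℝ} (hF : Continuous F) :
    ∫ x, F x ∂ν = (∫ x : G, ψ x * F x ∂μ) / ∫ x, ψ x ∂μ := by
  obtain ⟨c, hc⟩ := exists_integral_automorphize_eq_mul_integral ν μ
  have hcψ : 1 = c * ∫ x, ψ x ∂μ := by
    simpa [hψ.automorphize_eq_one] using hc ψ hψ.continuous hψ.hasCompactSupport
  have hcF : ∫ x, F x ∂ν = c * ∫ x : G, ψ x * F x ∂μ := by
    simpa only [automorphize_mul_comp_mk, hψ.automorphize_eq_one, one_mul] using
      hc (fun x : G => ψ x * F x) (hψ.continuous.mul (hF.comp QuotientGroup.continuous_mk))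
        hψ.hasCompactSupport.mul_right
  rw [hcF, eq_div_iff hψ.integral_pos.ne', mul_right_comm, ← hcψ, one_mul]

/-- The functional `F ↦ ∫ ψ F ∂μ / ∫ ψ ∂μ` on `C_c(G ⧸ Γ)` defined by a Bruhat function `ψ`. -/
noncomputable def functional (hψ : IsBruhatFunction Γ ψ) (μ : Measure G)
    [IsFiniteMeasureOnCompacts μ] : C_c(G ⧸ Γ, ℝ) →ₚ[ℝ] ℝ :=
  PositiveLinearMap.mk₀
    { toFun := fun F => (∫ x : G, ψ x * F x ∂μ) / ∫ x, ψ x ∂μ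
      map_add' := fun F₁ F₂ => by
        have integrable_mul_comp (F : C_c(G ⧸ Γ, ℝ)) : Integrable (fun x : G => ψ x * F x) μ :=
          hψ.integrable_mul (F.continuous.comp QuotientGroup.continuous_mk)
        rw [← add_div, ← integral_add (integrable_mul_comp F₁) (integrable_mul_comp F₂)]
        simp only [CompactlySupportedContinuousMap.add_apply, mul_add]
      map_smul' := fun c F => by
        rw [RingHom.id_apply, smul_eq_mul, ← mul_div_assoc, ← integral_const_mul]
        simp only [CompactlySupportedContinuousMap.smul_apply, smul_eq_mul, mul_left_comm] }
    fun _ hF => div_nonneg (integral_nonneg fun x => mul_nonneg (hψ.nonneg x) (hF _))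
      (integral_nonneg hψ.nonneg)

/-- The measure on `G ⧸ Γ` representing `hψ.functional μ`. For a Haar measure `μ` it is the
invariant probability measure on `G ⧸ Γ`, whichever Bruhat function `ψ` is used. -/
noncomputable def quotientMeasure (hψ : IsBruhatFunction Γ ψ) (μ : Measure G)
    [IsFiniteMeasureOnCompacts μ] : Measure (G ⧸ Γ) :=
  RealRMK.rieszMeasure (hψ.functional μ)

instance regular_quotientMeasure (hψ : IsBruhatFunction Γ ψ) (μ : Measure G)
    [IsFiniteMeasureOnCompacts μ] : (hψ.quotientMeasure μ).Regular :=
  RealRMK.regular_rieszMeasure _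

theorem integral_quotientMeasure (hψ : IsBruhatFunction Γ ψ) (μ : Measure G)
    [IsFiniteMeasureOnCompacts μ] (F : C_c(G ⧸ Γ, ℝ)) :
    ∫ x, F x ∂hψ.quotientMeasure μ = (∫ x : G, ψ x * F x ∂μ) / ∫ x, ψ x ∂μ :=
  RealRMK.integral_rieszMeasure _ F

instance isProbabilityMeasure_quotientMeasure (hψ : IsBruhatFunction Γ ψ)
    (μ : Measure G) [IsFiniteMeasureOnCompacts μ] [μ.IsOpenPosMeasure] :
    IsProbabilityMeasure (hψ.quotientMeasure μ) := by
  have := hψ.compactSpace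
  have hone := hψ.integral_quotientMeasure μ ⟨1, HasCompactSupport.of_compactSpace _⟩
  have hreal : (hψ.quotientMeasure μ).real univ = 1 := by
    simpa [div_self hψ.integral_pos.ne'] using hone
  exact ⟨(ENNReal.toReal_eq_one_iff _).mp hreal⟩

instance smulInvariantMeasure_quotientMeasure (hψ : IsBruhatFunction Γ ψ)
    (μ : Measure G) [IsFiniteMeasureOnCompacts μ] [μ.IsMulLeftInvariant] [μ.IsMulRightInvariant] :
    SMulInvariantMeasure G (G ⧸ Γ) (hψ.quotientMeasure μ) := by
  refine ((smulInvariantMeasure_tfae G (hψ.quotientMeasure μ)).out 0 5).mpr fun g => ?_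
  have : ((hψ.quotientMeasure μ).map (g • ·)).Regular := Measure.Regular.map (Homeomorph.smul g)
  refine Measure.ext_of_integral_eq_on_compactlySupported fun F => ?_
  let Fg : C_c(G ⧸ Γ, ℝ) := ⟨⟨fun x => F (g • x), by fun_prop⟩,
    F.2.comp_homeomorph (Homeomorph.smul g)⟩
  calc ∫ x, F x ∂((hψ.quotientMeasure μ).map (g • ·)) = ∫ x, Fg x ∂hψ.quotientMeasure μ :=
        integral_map (continuous_const_smul g).aemeasurable F.continuous.aestronglyMeasurable
    _ = (∫ x : G, ψ x * F (g • x) ∂μ) / ∫ x, ψ x ∂μ := hψ.integral_quotientMeasure μ Fg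
    _ = ∫ x, F x ∂hψ.quotientMeasure μ := by
        rw [hψ.integral_mul_comp_smul (F := F) F.continuous, integral_quotientMeasure]

theorem eq_quotientMeasure (hψ : IsBruhatFunction Γ ψ) (μ : Measure G) [μ.IsHaarMeasure]
    {ν : Measure (G ⧸ Γ)} [IsProbabilityMeasure ν] [ν.Regular]
    [SMulInvariantMeasure G (G ⧸ Γ) ν] : ν = hψ.quotientMeasure μ :=
  Measure.ext_of_integral_eq_on_compactlySupported fun F =>
    (hψ.integral_eq_integral_mul_div μ F.continuous).trans (hψ.integral_quotientMeasure μ F).symm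

end IsBruhatFunction

end QuotientMeasure

section NormalizedCounting

open Filter Set QuotientGroup

theorem finsum_mem_div_ncard_mem {α : Type*} {s : Set α} (hs : s.Finite) (hne : s.Nonempty)
    {φ : α → ℝ} {t : Set ℝ} (ht : Convex ℝ t) (hφ : MapsTo φ s t) :
    (∑ᶠ a ∈ s, φ a) / s.ncard ∈ t := by
  have hcard : (s.ncard : ℝ) ≠ 0 := Nat.cast_ne_zero.mpr (ncard_ne_zero_of_mem hne.some_mem hs)
  have hmean : ∑ a ∈ hs.toFinset, (s.ncard : ℝ)⁻¹ • φ a ∈ t := by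
    refine ht.sum_mem (fun _ _ => by positivity) ?_
      fun a ha => hφ (hs.mem_toFinset.mp ha)
    rw [Finset.sum_const, ← ncard_eq_toFinset_card s hs, nsmul_eq_mul, mul_inv_cancel₀ hcard]
  rwa [← Finset.smul_sum, ← finsum_mem_eq_finite_toFinset_sum φ hs, smul_eq_mul,
    inv_mul_eq_div] at hmean

variable {G : Type*} [Group G] [TopologicalSpace G]

/-- The discrete subgroups of `G`, as a subset of the Chabauty space. -/
def discreteSubgroups (G : Type*) [Group G] [TopologicalSpace G] : Set (ClosedSubgroup G) :=
  {H | DiscreteTopology H.toSubgroup}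

/-- A compact neighbourhood `W` of `1` whose translates `γ • W`, `γ ∈ Γ`, are pairwise disjoint.
The number of elements in `W` of a subgroup close to `Γ` is the factor by which sums over that
subgroup have to be normalized. -/
structure IsIsolatingNhd (Γ : ClosedSubgroup G) (W : Set G) : Prop where
  isCompact : IsCompact W
  mem_nhds_one : W ∈ 𝓝 1
  inter_div_subset : (Γ : Set G) ∩ (W / W) ⊆ {1}

variable {Γ : ClosedSubgroup G} {W : Set G}

theorem exists_isIsolatingNhd [IsTopologicalGroup G] [LocallyCompactSpace G]
    [DiscreteTopology Γ.toSubgroup] : ∃ W, IsIsolatingNhd Γ W := by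
  obtain ⟨U, hU, hUΓ⟩ := isOpen_induced_iff.mp (isOpen_discrete ({1} : Set Γ.toSubgroup))
  have h1U : (1 : Γ.toSubgroup) ∈ Subtype.val ⁻¹' U := hUΓ ▸ mem_singleton 1
  obtain ⟨V, hV, hVU⟩ := exists_nhds_split_inv (hU.mem_nhds h1U)
  obtain ⟨W, hW, hWV, hWc⟩ := local_compact_nhds hV
  refine ⟨W, hWc, hW, ?_⟩
  rintro x ⟨hxΓ, w, hw, w', hw', rfl⟩
  have hxU : (⟨w / w', hxΓ⟩ : Γ.toSubgroup) ∈ Subtype.val ⁻¹' U :=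
    hVU w (hWV hw) w' (hWV hw')
  rw [hUΓ] at hxU
  exact congrArg Subtype.val hxU

namespace IsIsolatingNhd

theorem inter_smul_subset (hW : IsIsolatingNhd Γ W) {γ : G} (hγ : γ ∈ Γ) :
    (Γ : Set G) ∩ γ • W ⊆ {γ} := by
  rintro _ ⟨hx, w, hw, rfl⟩
  have hwΓ : w ∈ Γ := (Subgroup.mul_mem_cancel_left Γ.toSubgroup hγ).mp hx
  have hw1 : w = 1 :=
    hW.inter_div_subset ⟨hwΓ, w, hw, 1, mem_of_mem_nhds hW.mem_nhds_one, div_one w⟩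
  simp [hw1]

theorem pairwiseDisjoint_smul (hW : IsIsolatingNhd Γ W) :
    (Γ : Set G).PairwiseDisjoint fun γ => γ • W := by
  refine fun γ hγ γ' hγ' hne => disjoint_left.mpr ?_
  rintro _ ⟨w, hw, rfl⟩ ⟨w', hw', h : γ' * w' = γ * w⟩
  have hdiv : γ⁻¹ * γ' = w / w' := by
    rw [inv_mul_eq_iff_eq_mul, ← mul_div_assoc, ← h, mul_div_cancel_right]
  have hone : γ⁻¹ * γ' = 1 := hW.inter_div_subset
    ⟨mul_mem (inv_mem hγ) hγ', hdiv ▸ div_mem_div hw hw'⟩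
  exact hne (inv_mul_eq_one.mp hone)

variable [IsTopologicalGroup G]

theorem finite_inter_smul [T2Space G] (hW : IsIsolatingNhd Γ W) {H : ClosedSubgroup G}
    (hH : H ∈ discreteSubgroups G) (γ : G) : ((H : Set G) ∩ γ • W).Finite :=
  have : DiscreteTopology H.toSubgroup := hH
  finite_inter_of_isCompact (Γ := H.toSubgroup) (hW.isCompact.smul γ)

theorem ncard_inter_ne_zero [T2Space G] (hW : IsIsolatingNhd Γ W) {H : ClosedSubgroup G}
    (hH : H ∈ discreteSubgroups G) : ((H : Set G) ∩ W).ncard ≠ 0 := by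
  refine ncard_ne_zero_of_mem (a := 1) ⟨one_mem H, mem_of_mem_nhds hW.mem_nhds_one⟩ ?_
  simpa using hW.finite_inter_smul hH 1

/- For `H` close to `Γ`, some `τ ∈ H` is close to `γ`, and then left translation by `τ` maps
`H ∩ W` onto `H ∩ γW`. -/
theorem eventually_ncard_inter_smul_eq (hW : IsIsolatingNhd Γ W) {γ : G} (hγ : γ ∈ Γ) :
    ∀ᶠ H : ClosedSubgroup G in 𝓝 Γ,
      ((H : Set G) ∩ γ • W).ncard = ((H : Set G) ∩ W).ncard := by
  obtain ⟨O, hO, h1O, hOW, hOW'⟩ : ∃ O : Set G, IsOpen O ∧ 1 ∈ O ∧ O * O ⊆ W ∧ O⁻¹ * O ⊆ W := by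
    obtain ⟨V, hV, h1V, hVW⟩ := exists_open_nhds_one_mul_subset hW.mem_nhds_one
    refine ⟨V ∩ V⁻¹, hV.inter hV.inv, ⟨h1V, by simpa⟩, ?_, ?_⟩
    · exact (mul_subset_mul inter_subset_left inter_subset_left).trans hVW
    · exact (mul_subset_mul (by simp [inter_inv]) inter_subset_left).trans hVW
  have hΓO : (Γ : Set G) ∩ W ⊆ O := by
    simpa [h1O] using (hW.inter_smul_subset (one_mem Γ)).trans (singleton_subset_iff.mpr h1O)
  have hΓγO : (Γ : Set G) ∩ γ • W ⊆ γ • O :=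
    (hW.inter_smul_subset hγ).trans (singleton_subset_iff.mpr ⟨1, h1O, mul_one γ⟩)
  filter_upwards [eventually_inter_subset hW.isCompact hO hΓO,
    eventually_inter_subset (hW.isCompact.smul γ) (hO.smul γ) hΓγO,
    (isOpen_setOf_inter_nonempty (hO.smul γ)).mem_nhds ⟨γ, hγ, 1, h1O, mul_one γ⟩]
    with H hHO hHγO ⟨τ, hτ, hτO⟩
  have htranslate : (H : Set G) ∩ γ • W = τ • ((H : Set G) ∩ W) := by
    obtain ⟨o, ho, rfl⟩ := hτO
    refine Subset.antisymm (fun x hx => ?_) ?_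
    · obtain ⟨o', ho', rfl⟩ := hHγO hx
      refine mem_smul_set_iff_inv_smul_mem.mpr ⟨mul_mem (inv_mem hτ) hx.1, hOW' ?_⟩
      exact ⟨o⁻¹, by simpa, o', ho', by simp [mul_assoc]⟩
    · rintro _ ⟨x, hx, rfl⟩
      refine ⟨mul_mem hτ hx.1, o * x, hOW (mul_mem_mul ho (hHO hx)), by simp [mul_assoc]⟩
  rw [htranslate, ncard_smul_set]

variable [T2Space G] {f : G → ℝ}

theorem tendsto_finsum_div_ncard (hW : IsIsolatingNhd Γ W) (hf : Continuous f) (g : G) {γ : G}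
    (hγ : γ ∈ Γ) :
    Tendsto (fun p : G × ClosedSubgroup G =>
        (∑ᶠ x ∈ (p.2 : Set G) ∩ γ • W, f (p.1 * x)) / ((p.2 : Set G) ∩ W).ncard)
      (𝓝 g ×ˢ 𝓝[discreteSubgroups G] Γ) (𝓝 (f (g * γ))) := by
  refine (Metric.nhds_basis_ball (x := f (g * γ))).tendsto_right_iff.mpr fun ε hε => ?_
  have hfε : ∀ᶠ q : G × G in 𝓝 (g, γ), f (q.1 * q.2) ∈ Metric.ball (f (g * γ)) ε :=
    (by fun_prop : Continuous fun q : G × G => f (q.1 * q.2)).continuousAt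
      (Metric.ball_mem_nhds _ hε)
  obtain ⟨V, U, hV, hgV, hU, hγU, hVU⟩ := mem_nhds_prod_iff'.mp hfε
  have hΓU := (hW.inter_smul_subset hγ).trans (singleton_subset_iff.mpr hγU)
  have hH := (eventually_inter_subset (hW.isCompact.smul γ) hU hΓU).and
    (hW.eventually_ncard_inter_smul_eq hγ)
  filter_upwards [prod_mem_prod (hV.mem_nhds hgV)
    (inter_mem (mem_nhdsWithin_of_mem_nhds hH) self_mem_nhdsWithin)]
  rintro ⟨g', H⟩ ⟨hg', ⟨hHU, hcard⟩, hHd⟩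
  have hne : ((H : Set G) ∩ γ • W).Nonempty :=
    nonempty_of_ncard_ne_zero (hcard.trans_ne (hW.ncard_inter_ne_zero hHd))
  simp only [← hcard]
  exact finsum_mem_div_ncard_mem (hW.finite_inter_smul hHd γ) hne (convex_ball _ _)
    fun x hx => hVU (mk_mem_prod hg' (hHU hx))

/- Near `(g, Γ)` the points of `H` contributing to the sum lie in the disjoint translates `γW`
indexed by the finitely many `γ ∈ Γ` close to `g⁻¹ supp f`. -/
theorem exists_finset_automorphize_eq_sum [LocallyCompactSpace G] [DiscreteTopology Γ.toSubgroup]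
    (hW : IsIsolatingNhd Γ W) (hfc : HasCompactSupport f) (g : G) :
    ∃ T : Finset G, (T : Set G) ⊆ Γ ∧
      automorphize f (g : G ⧸ Γ.toSubgroup) = ∑ γ ∈ T, f (g * γ) ∧
      ∀ᶠ p in 𝓝 g ×ˢ 𝓝[discreteSubgroups G] Γ, automorphize f (p.1 : G ⧸ p.2.toSubgroup) =
        ∑ γ ∈ T, ∑ᶠ x ∈ (p.2 : Set G) ∩ γ • W, f (p.1 * x) := by
  obtain ⟨V, hV, hVg⟩ := exists_compact_mem_nhds g
  set C : Set G := V⁻¹ * tsupport f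
  have mem_C {g' x : G} (hg' : g' ∈ V) (hx : f (g' * x) ≠ 0) : x ∈ C :=
    ⟨g'⁻¹, inv_mem_inv.mpr hg', g' * x, subset_tsupport f hx, inv_mul_cancel_left _ _⟩
  have hC : IsCompact C := hV.inv.mul hfc.isCompact
  have hT : ((Γ : Set G) ∩ C).Finite := finite_inter_of_isCompact (Γ := Γ.toSubgroup) hC
  have hcover : (Γ : Set G) ∩ C ⊆ ⋃ γ ∈ (Γ : Set G) ∩ C, γ • interior W := fun γ hγ =>
    mem_biUnion hγ ⟨1, mem_interior_iff_mem_nhds.mpr hW.mem_nhds_one, mul_one γ⟩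
  have hHcover := eventually_inter_subset hC
    (isOpen_biUnion fun γ _ => isOpen_interior.smul γ) hcover
  refine ⟨hT.toFinset, by simp, ?_, ?_⟩
  · rw [automorphize_mk_eq_finsum hfc, ← finsum_mem_eq_finite_toFinset_sum _ hT]
    exact finsum_mem_inter_support_eq' _ _ _ fun γ hγ =>
      (and_iff_left (mem_C (mem_of_mem_nhds hVg) hγ)).symm
  · filter_upwards [prod_mem_prod hVg
      (inter_mem (mem_nhdsWithin_of_mem_nhds hHcover) self_mem_nhdsWithin)]
    rintro ⟨g', H⟩ ⟨hg', hHC, hHd⟩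
    have : DiscreteTopology H.toSubgroup := hHd
    have hdisj : ((Γ : Set G) ∩ C).PairwiseDisjoint fun γ => (H : Set G) ∩ γ • W :=
      (hW.pairwiseDisjoint_smul.subset inter_subset_left).mono fun γ => inter_subset_right
    rw [automorphize_mk_eq_finsum hfc, ← finsum_mem_eq_finite_toFinset_sum _ hT,
      ← finsum_mem_biUnion hdisj hT fun γ _ => hW.finite_inter_smul hHd γ, ← inter_iUnion₂]
    refine finsum_mem_inter_support_eq' _ _ _ fun x hx => (and_iff_left_of_imp fun hxH => ?_).symm
    exact iUnion₂_mono (fun γ _ => smul_set_mono interior_subset) (hHC ⟨hxH, mem_C hg' hx⟩)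

theorem tendsto_automorphize_div_ncard [LocallyCompactSpace G] [DiscreteTopology Γ.toSubgroup]
    (hW : IsIsolatingNhd Γ W) (hf : Continuous f) (hfc : HasCompactSupport f) (g : G) :
    Tendsto (fun p : G × ClosedSubgroup G =>
        automorphize f (p.1 : G ⧸ p.2.toSubgroup) / ((p.2 : Set G) ∩ W).ncard)
      (𝓝 g ×ˢ 𝓝[discreteSubgroups G] Γ) (𝓝 (automorphize f (g : G ⧸ Γ.toSubgroup))) := by
  obtain ⟨T, hTΓ, hg, hp⟩ := hW.exists_finset_automorphize_eq_sum hfc g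
  rw [hg]
  refine (tendsto_finsetSum T fun γ hγ =>
    hW.tendsto_finsum_div_ncard hf g (hTΓ hγ)).congr' ?_
  filter_upwards [hp] with p hp
  rw [hp, Finset.sum_div]

end IsIsolatingNhd

end NormalizedCounting

section Continuity

open Filter Set QuotientGroup

theorem tendsto_setIntegral_of_tendstoUniformlyOn {α ι : Type*} [MeasurableSpace α]
    {μ : Measure α} {l : Filter ι} {F : ι → α → ℝ} {F₀ : α → ℝ} {s : Set α}
    (hμs : μ s < ⊤) (hF : ∀ᶠ i in l, IntegrableOn (F i) s μ)
    (hF₀ : IntegrableOn F₀ s μ) (h : TendstoUniformlyOn F F₀ l s) :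
    Tendsto (fun i => ∫ x in s, F i x ∂μ) l (𝓝 (∫ x in s, F₀ x ∂μ)) := by
  refine Metric.tendsto_nhds.mpr fun ε hε => ?_
  obtain ⟨δ, hδ, hδε⟩ : ∃ δ > 0, δ * μ.real s < ε := by
    simpa only [mul_comm] using exists_pos_mul_lt hε (μ.real s)
  filter_upwards [hF, Metric.tendstoUniformlyOn_iff.mp h δ hδ] with i hFi hi
  rw [dist_comm, dist_eq_norm, ← integral_sub hF₀ hFi]
  exact (norm_setIntegral_le_of_norm_le_const hμs fun x hx =>
    (dist_eq_norm (F₀ x) (F i x)) ▸ (hi x hx).le).trans_lt hδε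

theorem tendsto_integral_of_forall_tendsto_prod {X ι : Type*} [TopologicalSpace X] [T2Space X]
    [MeasurableSpace X] [OpensMeasurableSpace X] {μ : Measure X} [IsFiniteMeasureOnCompacts μ]
    {l : Filter ι} {F : ι → X → ℝ} {F₀ : X → ℝ} {K : Set X} (hK : IsCompact K)
    (hFK : ∀ i, ∀ x ∉ K, F i x = 0) (hF₀K : ∀ x ∉ K, F₀ x = 0)
    (hF : ∀ᶠ i in l, Continuous (F i)) (hF₀ : Continuous F₀)
    (h : ∀ x ∈ K, Tendsto (fun p : X × ι => F p.2 p.1) (𝓝 x ×ˢ l) (𝓝 (F₀ x))) :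
    Tendsto (fun i => ∫ x, F i x ∂μ) l (𝓝 (∫ x, F₀ x ∂μ)) := by
  have huniform : TendstoUniformlyOn F F₀ l K := by
    rw [← tendstoLocallyUniformlyOn_iff_tendstoUniformlyOn_of_compact hK,
      tendstoLocallyUniformlyOn_iff_forall_tendsto]
    refine fun x hx => Tendsto.mono_right (Tendsto.prodMk_nhds ?_ ?_) (nhds_le_uniformity (F₀ x))
    · exact (hF₀.continuousAt.mono_left nhdsWithin_le_nhds).comp tendsto_snd
    · exact (h x hx).comp ((tendsto_snd.mono_right nhdsWithin_le_nhds).prodMk tendsto_fst)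
  have hlim := tendsto_setIntegral_of_tendstoUniformlyOn (μ := μ)
    hK.measure_lt_top (hF.mono fun i hi => hi.continuousOn.integrableOn_compact hK)
    (hF₀.continuousOn.integrableOn_compact hK) huniform
  rw [setIntegral_eq_integral_of_forall_compl_eq_zero hF₀K] at hlim
  exact hlim.congr fun i => setIntegral_eq_integral_of_forall_compl_eq_zero (hFK i)

variable {G : Type*} [Group G] [TopologicalSpace G] [IsTopologicalGroup G] [T2Space G]
  [LocallyCompactSpace G] [MeasurableSpace G] [BorelSpace G] {μ : Measure G}
  {Γ : ClosedSubgroup G} {f : G → ℝ} {u : G × ClosedSubgroup G → ℝ}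

theorem IsIsolatingNhd.tendsto_ncard_mul_integral [IsFiniteMeasureOnCompacts μ]
    [DiscreteTopology Γ.toSubgroup] {W : Set G} (hW : IsIsolatingNhd Γ W) (hf : Continuous f)
    (hfc : HasCompactSupport f)
    (hpos : ∀ᶠ H in 𝓝[discreteSubgroups G] Γ, ∀ x : G ⧸ H.toSubgroup, 0 < automorphize f x)
    (hu : Continuous u) :
    Tendsto (fun H : ClosedSubgroup G => ((H : Set G) ∩ W).ncard *
        ∫ x, f x / automorphize f (x : G ⧸ H.toSubgroup) * u (x, H) ∂μ)
      (𝓝[discreteSubgroups G] Γ)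
      (𝓝 (∫ x, f x / automorphize f (x : G ⧸ Γ.toSubgroup) * u (x, Γ) ∂μ)) := by
  have hΓ : Γ ∈ discreteSubgroups G := ‹DiscreteTopology Γ.toSubgroup›
  have hposΓ := hpos.self_of_nhdsWithin hΓ
  have continuous_integrand {H : ClosedSubgroup G} (hH : H ∈ discreteSubgroups G)
      (hHpos : ∀ x : G ⧸ H.toSubgroup, 0 < automorphize f x) :
      Continuous fun x => f x / automorphize f (x : G ⧸ H.toSubgroup) * u (x, H) := by
    have : DiscreteTopology H.toSubgroup := hH
    have hP : Continuous fun x : G => automorphize f (x : G ⧸ H.toSubgroup) :=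
      (continuous_automorphize hf hfc).comp QuotientGroup.continuous_mk
    exact (hf.div hP fun x => (hHpos x).ne').mul (by fun_prop)
  simp only [← integral_const_mul]
  refine tendsto_integral_of_forall_tendsto_prod hfc.isCompact ?_ ?_ ?_
    (continuous_integrand hΓ hposΓ) fun x _ => ?_
  · intro H x hx
    simp [image_eq_zero_of_notMem_tsupport hx]
  · intro x hx
    simp [image_eq_zero_of_notMem_tsupport hx]
  · filter_upwards [hpos, self_mem_nhdsWithin] with H hHpos hH
    exact (continuous_integrand hH hHpos).const_mul _
  · have hlim_u : Tendsto u (𝓝 x ×ˢ 𝓝[discreteSubgroups G] Γ) (𝓝 (u (x, Γ))) :=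
      (nhds_prod_eq (X := G) (Y := ClosedSubgroup G) ▸ hu.tendsto (x, Γ)).mono_left
        (prod_mono_right _ nhdsWithin_le_nhds)
    have hlim := (((hf.tendsto x).comp tendsto_fst).div
      (hW.tendsto_automorphize_div_ncard hf hfc x) (hposΓ x).ne').mul hlim_u
    refine hlim.congr fun p => ?_
    simp only [Function.comp_apply, Pi.div_apply, div_div_eq_mul_div]
    ring

/- The normalizing factors cancel in the quotient. -/
theorem tendsto_integral_div_automorphize [μ.IsHaarMeasure] [DiscreteTopology Γ.toSubgroup]
    (hf : Continuous f) (hfc : HasCompactSupport f) (hf0 : ∀ x, 0 ≤ f x)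
    (hpos : ∀ᶠ H in 𝓝[discreteSubgroups G] Γ, ∀ x : G ⧸ H.toSubgroup, 0 < automorphize f x)
    (hu : Continuous u) :
    Tendsto (fun H : ClosedSubgroup G =>
        (∫ x, f x / automorphize f (x : G ⧸ H.toSubgroup) * u (x, H) ∂μ) /
          ∫ x, f x / automorphize f (x : G ⧸ H.toSubgroup) ∂μ)
      (𝓝[discreteSubgroups G] Γ)
      (𝓝 ((∫ x, f x / automorphize f (x : G ⧸ Γ.toSubgroup) * u (x, Γ) ∂μ) /
          ∫ x, f x / automorphize f (x : G ⧸ Γ.toSubgroup) ∂μ)) := by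
  obtain ⟨W, hW⟩ := exists_isIsolatingNhd (Γ := Γ)
  have hψ := isBruhatFunction_div_automorphize hf hfc hf0
    (hpos.self_of_nhdsWithin ‹DiscreteTopology Γ.toSubgroup›)
  have hmass := hW.tendsto_ncard_mul_integral (μ := μ) (u := fun _ => 1) hf hfc hpos
    continuous_const
  simp only [mul_one] at hmass
  refine ((hW.tendsto_ncard_mul_integral hf hfc hpos hu).div hmass hψ.integral_pos.ne').congr' ?_
  filter_upwards [self_mem_nhdsWithin] with H hH
  exact mul_div_mul_left _ _ (Nat.cast_ne_zero.mpr (hW.ncard_inter_ne_zero hH))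

end Continuity

section InvariantRandomSubgroups

open Filter Set QuotientGroup

variable {G : Type*} [Group G] [TopologicalSpace G] [IsTopologicalGroup G]

namespace ULat

instance discreteTopology (Γ : ULat G) : DiscreteTopology Γ.1.toSubgroup := Γ.2.1

theorem conjClosed_cosetConj (Γ : ULat G) (g : G) (x : Γ.Cosets) :
    conjClosed g (Γ.cosetConj x) = Γ.cosetConj (g • x) := by
  obtain ⟨a, rfl⟩ := QuotientGroup.mk_surjective x
  exact conjClosed_conjClosed g a Γ.1

theorem IsInvariantProbability.smulInvariantMeasure {Γ : ULat G} {ν : Γ.CosetMeasure}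
    (hν : Γ.IsInvariantProbability ν) : @SMulInvariantMeasure G Γ.Cosets _ (borel Γ.Cosets) ν := by
  let _ : MeasurableSpace Γ.Cosets := borel _
  have : BorelSpace Γ.Cosets := ⟨rfl⟩
  exact ((smulInvariantMeasure_tfae G ν).out 0 5).mpr hν.invariant

variable [LocallyCompactSpace G]

theorem continuous_cosetConj (Γ : ULat G) : Continuous Γ.cosetConj :=
  (continuous_conjClosed.comp (Continuous.prodMk_left Γ.1)).quotient_lift _

theorem integral_pushforward (Γ : ULat G) (ν : Γ.CosetMeasure) {Ψ : ClosedSubgroup G → ℝ}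
    (hΨ : Continuous Ψ) : ∫ H, Ψ H ∂(Γ.pushforward ν) = ∫ x, Ψ (Γ.cosetConj x) ∂ν := by
  let _ : MeasurableSpace Γ.Cosets := borel _
  have : BorelSpace Γ.Cosets := ⟨rfl⟩
  exact integral_map Γ.continuous_cosetConj.aemeasurable hΨ.aestronglyMeasurable

namespace IsInvariantProbability

variable {Γ : ULat G} {ν : Γ.CosetMeasure}

theorem map_conjClosed_pushforward (hν : Γ.IsInvariantProbability ν) (g : G) :
    (Γ.pushforward ν).map (conjClosed g) = Γ.pushforward ν := by
  let _ : MeasurableSpace Γ.Cosets := borel _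
  have : BorelSpace Γ.Cosets := ⟨rfl⟩
  have hcoset : Measurable Γ.cosetConj := Γ.continuous_cosetConj.measurable
  have hconj : Measurable (conjClosed g : ClosedSubgroup G → ClosedSubgroup G) :=
    (continuous_conjClosed.comp (Continuous.prodMk_right g)).measurable
  calc (Γ.pushforward ν).map (conjClosed g) = ν.map (conjClosed g ∘ Γ.cosetConj) :=
        Measure.map_map hconj hcoset
    _ = ν.map (Γ.cosetConj ∘ (g • ·)) := by
        rw [show conjClosed g ∘ Γ.cosetConj = Γ.cosetConj ∘ (g • ·) from
          funext (Γ.conjClosed_cosetConj g)]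
    _ = (ν.map (g • ·)).map Γ.cosetConj :=
        (Measure.map_map hcoset (continuous_const_smul g).measurable).symm
    _ = Γ.pushforward ν := by rw [hν.invariant g]; rfl

/-- The invariant random subgroup induced by the invariant probability measure `ν` on `G ⧸ Γ`. -/
noncomputable def toIRS (hν : Γ.IsInvariantProbability ν) : IRS G :=
  let _ : MeasurableSpace Γ.Cosets := borel _
  have : BorelSpace Γ.Cosets := ⟨rfl⟩
  have := hν.isProbability
  have := hν.regular
  have hprob : IsProbabilityMeasure (Γ.pushforward ν) :=
    Measure.isProbabilityMeasure_map Γ.continuous_cosetConj.aemeasurable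
  have : (Γ.pushforward ν).InnerRegular :=
    Measure.InnerRegular.map_of_continuous Γ.continuous_cosetConj
  ⟨⟨Γ.pushforward ν, hprob⟩, (inferInstance : (Γ.pushforward ν).Regular),
    hν.map_conjClosed_pushforward⟩

end IsInvariantProbability

variable [T2Space G]

theorem existsUnique_isInvariantProbability (Γ : ULat G) :
    ∃! ν : Γ.CosetMeasure, Γ.IsInvariantProbability ν := by
  let _ : MeasurableSpace G := borel G
  have : BorelSpace G := ⟨rfl⟩
  let _ : MeasurableSpace Γ.Cosets := borel _
  have : BorelSpace Γ.Cosets := ⟨rfl⟩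
  obtain ⟨K, hK, hKΓ⟩ := Γ.2.exists_isCompact_mul_eq_univ
  obtain ⟨ψ, hψ⟩ := exists_isBruhatFunction hK hKΓ
  have := hψ.isMulRightInvariant Measure.haar
  refine ⟨hψ.quotientMeasure Measure.haar,
    ⟨inferInstance, inferInstance, fun g => MeasureTheory.map_smul g _⟩, fun ν hν => ?_⟩
  have := hν.isProbability
  have := hν.regular
  have := hν.smulInvariantMeasure
  exact hψ.eq_quotientMeasure Measure.haar

/-- The invariant random subgroup `μ_Γ` of the uniform lattice `Γ`. -/
noncomputable def toIRS (Γ : ULat G) : IRS G :=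
  Γ.existsUnique_isInvariantProbability.exists.choose_spec.toIRS

theorem coe_toIRS (Γ : ULat G) {ν : Γ.CosetMeasure} (hν : Γ.IsInvariantProbability ν) :
    (Γ.toIRS.1 : Measure (ClosedSubgroup G)) = Γ.pushforward ν :=
  congrArg Γ.pushforward (Γ.existsUnique_isInvariantProbability.unique
    Γ.existsUnique_isInvariantProbability.exists.choose_spec hν)

theorem integral_toIRS [MeasurableSpace G] [BorelSpace G] (Γ : ULat G) {ψ : G → ℝ}
    (hψ : IsBruhatFunction Γ.1.toSubgroup ψ) (μ : Measure G) [μ.IsHaarMeasure]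
    {Ψ : ClosedSubgroup G → ℝ} (hΨ : Continuous Ψ) :
    ∫ H, Ψ H ∂(Γ.toIRS.1 : Measure (ClosedSubgroup G)) =
      (∫ x, ψ x * Ψ (conjClosed x Γ.1) ∂μ) / ∫ x, ψ x ∂μ := by
  let _ : MeasurableSpace Γ.Cosets := borel _
  have : BorelSpace Γ.Cosets := ⟨rfl⟩
  obtain ⟨ν, hν⟩ := Γ.existsUnique_isInvariantProbability.exists
  have := hν.isProbability
  have := hν.smulInvariantMeasure
  rw [Γ.coe_toIRS hν, Γ.integral_pushforward ν hΨ]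
  exact hψ.integral_eq_integral_mul_div μ (hΨ.comp Γ.continuous_cosetConj)

theorem continuous_toIRS (hG : IsCompactlyGeneratedGroup G) :
    Continuous (toIRS : ULat G → IRS G) := by
  let _ : MeasurableSpace G := borel G
  have : BorelSpace G := ⟨rfl⟩
  refine continuous_iff_continuousAt.mpr fun Γ => tendsto_subtype_rng.mpr
    (ProbabilityMeasure.tendsto_iff_forall_integral_tendsto.mpr fun Ψ => ?_)
  obtain ⟨K, hK, hKΓ⟩ := Γ.2.exists_isCompact_mul_eq_univ
  obtain ⟨L, hL, hLH⟩ := eventually_mul_eq_univ hG hK hKΓ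
  obtain ⟨f, hfL, -, hfc, hfI⟩ :=
    exists_continuous_one_zero_of_isCompact hL isClosed_empty (disjoint_empty L)
  have hf0 (x : G) : 0 ≤ f x := (hfI x).1
  have hpos : ∀ᶠ H in 𝓝[discreteSubgroups G] Γ.1,
      ∀ x : G ⧸ H.toSubgroup, 0 < automorphize f x := by
    filter_upwards [mem_nhdsWithin_of_mem_nhds hLH, self_mem_nhdsWithin] with H hLH hH
    have : DiscreteTopology H.toSubgroup := hH
    exact automorphize_pos hfc hf0 (fun x hx => by simp [hfL hx]) hLH
  have hval : Tendsto (Subtype.val : ULat G → ClosedSubgroup G) (𝓝 Γ)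
      (𝓝[discreteSubgroups G] Γ.1) :=
    tendsto_nhdsWithin_iff.mpr ⟨continuous_subtype_val.continuousAt, .of_forall discreteTopology⟩
  have hintegral (Γ' : ULat G) (h : ∀ x : Γ'.Cosets, 0 < automorphize f x) :=
    Γ'.integral_toIRS (isBruhatFunction_div_automorphize f.continuous hfc hf0 h)
      Measure.haar Ψ.continuous
  rw [hintegral Γ (hpos.self_of_nhdsWithin Γ.2.1)]
  refine ((tendsto_integral_div_automorphize (u := fun p => Ψ (conjClosed p.1 p.2)) f.continuous
    hfc hf0 hpos (Ψ.continuous.comp continuous_conjClosed)).comp hval).congr' ?_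
  filter_upwards [hval hpos] with Γ' h using (hintegral Γ' h).symm

end ULat

end InvariantRandomSubgroups

theorem proposition9 (G : Type*) [Group G] [TopologicalSpace G] [IsTopologicalGroup G]
    [T2Space G] [LocallyCompactSpace G] (hG : IsCompactlyGeneratedGroup G) :
    (∀ Γ : ULat G, ∃! ν : Γ.CosetMeasure, Γ.IsInvariantProbability ν) ∧
    ∃ I : ULat G → IRS G,
      (∀ (Γ : ULat G) (ν : Γ.CosetMeasure), Γ.IsInvariantProbability ν →
        ((I Γ).1 : MeasureTheory.Measure (ClosedSubgroup G)) = Γ.pushforward ν) ∧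
      Continuous I :=
  ⟨ULat.existsUnique_isInvariantProbability, ULat.toIRS, fun Γ _ => Γ.coe_toIRS,
    ULat.continuous_toIRS hG⟩
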